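/- Let $M\subset\mathbb R^3$ be a complete convex surface of class $C^2$ (the whole boundary of a closed convex set with nonempty interior) whose Gaussian curvature $K$ satisfies $0<K_1<K<K_2$ for some constants $K_1,K_2$. Let $Q\subset M$ be a convex geodesic quadrilateral with consecutive vertices $A^\circ,B^\circ,C^\circ,D^\circ$, that is, a closed region in which any two points are joined by a shortest arc of $M$ and whose relative boundary is a simple closed curve made of the shortest arcs $A^\circ B^\circ$, $B^\circ C^\circ$, $C^\circ D^\circ$, $D^\circ A^\circ$. Let $w_A,w_B,w_C,w_D>0$ and let $P_F$ be a weighted Fermat--Torricelli point lying in the interior of $Q$: a point which minimizes $X\mapsto\sum_{R}w_R\,d_M(X,R^\circ)$ over $Q$, where $d_M$ is the intrinsic distance of $M$. For $R\in\{A,B,C,D\}$ let $\gamma_R$ be a unit speed geodesic of $M$ which starts at $P_F$ with a shortest arc from $P_F$ to $R^\circ$, let $u_R=\gamma_R'(0)$, and put $R=\gamma_R(w_R)$ and $R'=w_Ru_R\in T_{P_F}M$, with $P_F$ taken as the origin of $T_{P_F}M$. Thus $R$ lies on the geodesic $P_FR^\circ$, $\exp_{P_F}(R')=R$ and $|P_FR'|=w_R$.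 Write $X^\star=-X$ for the reflection of $X\in T_{P_F}M$ through $P_F$. Call $XYZW$ a parallelogram if $Y-X=Z-W$. Then: * (Class A) $A'^\star B'C'^\star D'$ is a parallelogram in $T_{P_F}M$. * (Class B) $A'B'^\star C'D'^\star$ is a parallelogram in $T_{P_F}M$. * If $u_A,u_B,u_C,u_D$ follow each other counterclockwise (for one of the two orientations of $T_{P_F}M$) with all angles $\angle A^\circ P_FB^\circ$, $\angle B^\circ P_FC^\circ$, $\angle C^\circ P_FD^\circ$, $\angle D^\circ P_FA^\circ$ in $(0,\pi)$, then both parallelograms are nondegenerate (not contained in a line). * (Plasticity) Suppose that $u_A,u_B,u_C$ are pairwise linearly independent. For three distinct vertices $S,L,N$ let $(w_S,w_L,w_N)_{SLN}\neq(0,0,0)$ be real numbers, unique up to a common factor in the cases used below, with $(w_S)_{SLN}u_S+(w_L)_{SLN}u_L+(w_N)_{SLN}u_N=0$. Let $c$ be a real number and let $\tilde w_A,\tilde w_B,\tilde w_C,\tilde w_D>0$ have sum $c$. Then these weights satisfy the plasticity equations $$\frac{\tilde w_B}{\tilde w_A}=\Big(\frac{w_B}{w_A}\Big)_{ABC}\Big[1-\frac{\tilde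 w_D}{\tilde w_A}\Big(\frac{w_A}{w_D}\Big)_{ACD}\Big],\qquad \frac{\tilde w_C}{\tilde w_A}=\Big(\frac{w_C}{w_A}\Big)_{ABC}\Big[1-\frac{\tilde w_D}{\tilde w_A}\Big(\frac{w_A}{w_D}\Big)_{ABD}\Big]$$ if and only if the points $\tilde w_Ru_R$ $(R\in\{A,B,C,D\})$ form a parallelogram after the reflection of Class A, and also if and only if they form a parallelogram after the reflection of Class B. -/

import Mathlib

open Set Topology

noncomputable section

/-- Euclidean three-space. -/
abbrev E3 : Type := EuclideanSpace ℝ (Fin 3)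

/-- `v` is a tangent vector of `M` at `p`: the velocity of a curve lying in `M`. -/
def IsTangent (M : Set E3) (p v : E3) : Prop :=
  ∃ c : ℝ → E3, (∀ t, c t ∈ M) ∧ c 0 = p ∧ HasDerivAt c v 0

/-- `n` is a `C¹` field on the open set `U` whose restriction to `M ∩ U` is a unit normal field. -/
def IsUnitNormalField (M U : Set E3) (n : E3 → E3) : Prop :=
  ContDiffOn ℝ 1 n U ∧
    ∀ x ∈ M ∩ U, ‖n x‖ = 1 ∧ ∀ v, IsTangent M x v → inner ℝ (n x) v = 0

/-- The Gaussian curvature of `M` at `p` is `κ`: it is the determinant of the differential of the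
Gauss map on the tangent plane, computed in an orthonormal basis `e₁, e₂` of that plane. -/
def HasGaussCurvatureAt (M : Set E3) (p : E3) (κ : ℝ) : Prop :=
  ∃ (U : Set E3) (n : E3 → E3) (e₁ e₂ : E3),
    IsOpen U ∧ p ∈ U ∧ IsUnitNormalField M U n ∧
    IsTangent M p e₁ ∧ IsTangent M p e₂ ∧ ‖e₁‖ = 1 ∧ ‖e₂‖ = 1 ∧ inner ℝ e₁ e₂ = 0 ∧
    κ = inner ℝ (fderiv ℝ n p e₁) e₁ * inner ℝ (fderiv ℝ n p e₂) e₂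
      - inner ℝ (fderiv ℝ n p e₁) e₂ * inner ℝ (fderiv ℝ n p e₂) e₁

/-- A complete convex surface of class `C²` in three-space whose Gaussian curvature lies strictly
between two positive constants. -/
structure IsConvexSurface (M : Set E3) : Prop where
  /-- `M` is the whole boundary of a closed convex set with interior points. -/
  boundary : ∃ K : Set E3, IsClosed K ∧ Convex ℝ K ∧ (interior K).Nonempty ∧ M = frontier K
  /-- `M` is locally a regular level set of a `C²` function. -/
  regular : ∀ p ∈ M, ∃ (U : Set E3) (g : E3 → ℝ), IsOpen U ∧ p ∈ U ∧ ContDiffOn ℝ 2 g U ∧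
    fderiv ℝ g p ≠ 0 ∧ M ∩ U = {x ∈ U | g x = 0}
  curvature : ∃ K₁ K₂ : ℝ, 0 < K₁ ∧
    ∀ p ∈ M, ∃ κ : ℝ, HasGaussCurvatureAt M p κ ∧ K₁ < κ ∧ κ < K₂

/-- `c` restricted to `[0, 1]` is a continuous curve in `M` from `p` to `q`. -/
def IsCurveIn (M : Set E3) (p q : E3) (c : ℝ → E3) : Prop :=
  ContinuousOn c (Icc 0 1) ∧ MapsTo c (Icc 0 1) M ∧ c 0 = p ∧ c 1 = q

/-- Intrinsic distance of `M`: the infimum of the lengths of the curves in `M` from `p` to `q`. -/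
def intrinsicEDist (M : Set E3) (p q : E3) : ENNReal :=
  ⨅ (c : ℝ → E3) (_ : IsCurveIn M p q c), eVariationOn c (Icc 0 1)

/-- The intrinsic distance as a real number. -/
def intrinsicDist (M : Set E3) (p q : E3) : ℝ := (intrinsicEDist M p q).toReal

/-- `S` is (the trace of) a shortest arc of `M` from `p` to `q`. -/
def IsShortestArc (M : Set E3) (p q : E3) (S : Set E3) : Prop :=
  ∃ c : ℝ → E3, IsCurveIn M p q c ∧ S = c '' Icc 0 1 ∧
    eVariationOn c (Icc 0 1) = intrinsicEDist M p q ∧ intrinsicEDist M p q ≠ ⊤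

/-- A complete geodesic of `M`: a `C²` curve in `M` whose acceleration is normal to `M`. -/
def IsGeodesic (M : Set E3) (γ : ℝ → E3) : Prop :=
  ContDiff ℝ 2 γ ∧ (∀ t, γ t ∈ M) ∧
    ∀ t v, IsTangent M (γ t) v → inner ℝ (deriv (deriv γ) t) v = 0

/-- `exp_p v = q`. -/
def IsExp (M : Set E3) (p v q : E3) : Prop :=
  ∃ γ : ℝ → E3, IsGeodesic M γ ∧ γ 0 = p ∧ deriv γ 0 = v ∧ γ 1 = q

/-- `γ` is the complete unit speed geodesic starting at `p` with a shortest arc from `p` to `q`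
(its length from `p` to `q` is the intrinsic distance). -/
def IsGeodesicTo (M : Set E3) (p q : E3) (γ : ℝ → E3) : Prop :=
  IsGeodesic M γ ∧ γ 0 = p ∧ ‖deriv γ 0‖ = 1 ∧ γ (intrinsicDist M p q) = q

/-- `Q` is a convex geodesic quadrilateral of `M` with the consecutive vertices
`V 0, V 1, V 2, V 3`: a closed region in which any two points are joined by a shortest arc of `M`
and whose relative boundary is a simple closed curve formed by four shortest arcs of `M`
joining consecutive vertices (indices modulo 4). -/
structure IsConvexQuadrilateral (M : Set E3) (V : Fin 4 → E3) (Q : Set E3) : Prop where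
  subset : Q ⊆ M
  closed : IsClosed Q
  convex : ∀ x ∈ Q, ∀ y ∈ Q, ∃ S ⊆ Q, IsShortestArc M x y S
  boundary : ∃ S : Fin 4 → Set E3,
    (∀ i, IsShortestArc M (V i) (V (i + 1)) (S i)) ∧
    (∀ i, S i ∩ S (i + 1) = {V (i + 1)}) ∧ (∀ i, S i ∩ S (i + 2) = ∅) ∧
    {x ∈ Q | Q ∉ 𝓝[M] x} = ⋃ i, S i

/-- `P` is an interior point, relative to `M`, of the region `Q`. -/
def IsInteriorPoint (M Q : Set E3) (P : E3) : Prop := P ∈ Q ∧ Q ∈ 𝓝[M] P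

/-- `P` is a weighted Fermat-Torricelli point in the region `Q` of the points `V i` with
weights `w i`: it minimizes the weighted sum of the intrinsic distances to the `V i`. -/
def IsFermatTorricelliPoint (M Q : Set E3) (V : Fin 4 → E3) (w : Fin 4 → ℝ) (P : E3) : Prop :=
  P ∈ Q ∧ ∀ x ∈ Q, ∑ i, w i * intrinsicDist M P (V i) ≤ ∑ i, w i * intrinsicDist M x (V i)

/-- `XYZW` is a parallelogram, possibly flat: the sides `XY` and `WZ`, hence also `XW` and `YZ`,
are equal and parallel. -/
def IsParallelogram (X Y Z W : E3) : Prop := Y - X = Z - W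

/-- `XYZW` is a parallelogram that does not degenerate to a subset of a line. -/
def IsProperParallelogram (X Y Z W : E3) : Prop :=
  IsParallelogram X Y Z W ∧ LinearIndependent ℝ ![Y - X, W - X]

/-- For a unit normal vector `ν` of a plane and unit vectors `u, v` of that plane: the sine of the
angle from `u` to `v`, the plane being oriented by `ν`. -/
def orientedSin (ν u v : E3) : ℝ :=
  Matrix.det (Matrix.of fun i j => (![ν, u, v] i) j)

/-- The directions `u 0, u 1, u 2, u 3` tangent to `M` at `P` follow each other counterclockwise,
for one of the two orientations, with angles between `0` and `π` from each one to the next. -/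
def IsCounterclockwise (M : Set E3) (P : E3) (u : Fin 4 → E3) : Prop :=
  ∃ ν : E3, ‖ν‖ = 1 ∧ (∀ v, IsTangent M P v → inner ℝ ν v = 0) ∧
    ∀ i, 0 < orientedSin ν (u i) (u (i + 1))

/-- `a` is a system of weights (of any sign) of a triangle whose vertices are seen from the given
point in the unit directions `u, v, w`: the weighted directions balance. -/
def IsTriangleWeights (u v w : E3) (a : Fin 3 → ℝ) : Prop :=
  a ≠ 0 ∧ a 0 • u + a 1 • v + a 2 • w = 0

/-- The plasticity equations for weights `w 0, w 1, w 2, w 3` (of `A, B, C, D`) with sum `c`;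
`p`, `q`, `r` are the weights of the triangles `ABC`, `ACD`, `ABD` at the same point:
`(w_B/w_A)_{ABCD} = (w_B/w_A)_{ABC} [1 - (w_D/w_A)_{ABCD} (w_A/w_D)_{ACD}]`,
`(w_C/w_A)_{ABCD} = (w_C/w_A)_{ABC} [1 - (w_D/w_A)_{ABCD} (w_A/w_D)_{ABD}]`. -/
def PlasticityEquations (u : Fin 4 → E3) (c : ℝ) (w : Fin 4 → ℝ) : Prop :=
  ∑ i, w i = c ∧
  ∀ p q r : Fin 3 → ℝ, IsTriangleWeights (u 0) (u 1) (u 2) p →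
    IsTriangleWeights (u 0) (u 2) (u 3) q → IsTriangleWeights (u 0) (u 1) (u 3) r →
    w 1 / w 0 = p 1 / p 0 * (1 - w 3 / w 0 * (q 0 / q 2)) ∧
    w 2 / w 0 = p 2 / p 0 * (1 - w 3 / w 0 * (r 0 / r 2))

/-- The points `A', B', C', D'` of the tangent plane at `P`, written as vectors from `P`: they lie
in the directions `u i` at the distances `w i` from `P`. -/
def tangentPoint (u : Fin 4 → E3) (w : Fin 4 → ℝ) (i : Fin 4) : E3 := w i • u i

end

/-! Both parallelogram conditions are rearrangements of the single equation `∑ w_i u_i = 0`, so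
everything rests on the first-order condition at an interior minimum, `sum_smul_direction_eq_zero`.

Put `v = ∑ w_i u_i` and move `P` along `v`. An upper bound for each distance, with linear term
`-t⟨u_i, v⟩` and error `O(t²)`, is enough: the weighted sum then changes by at most `-t‖v‖² +
O(t²)`, and minimality forces `v = 0`. No differentiability of the distance is needed.

The bound comes from competing curves. The start of the geodesic is displaced inside the tangent
planes, which miss the interior of the body, and the metric projection onto the body returns the
curve to the surface without lengthening it.

Nondegeneracy is a determinant computation from the balance, and plasticity is the balance read in
the basis `u 1, u 2` of the tangent plane. -/

/-! ### Orthogonality in three-space and tangent planes -/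

/-- If `e₁, e₂, n` is an orthonormal frame, a vector orthogonal to `e₁, e₂` is orthogonal to
every vector orthogonal to `n`. -/
theorem inner_eq_zero_of_orthonormal_frame {e₁ e₂ n f W : E3} (h₁ : ‖e₁‖ = 1) (h₂ : ‖e₂‖ = 1)
    (h₁₂ : inner ℝ e₁ e₂ = 0) (hn : ‖n‖ = 1) (hn₁ : inner ℝ n e₁ = 0) (hn₂ : inner ℝ n e₂ = 0)
    (hf₁ : inner ℝ f e₁ = 0) (hf₂ : inner ℝ f e₂ = 0) (hW : inner ℝ n W = 0) :
    inner ℝ f W = 0 := by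
  have ho : Orthonormal ℝ ![e₁, e₂, n] := by
    refine ⟨fun i => by fin_cases i <;> simp [h₁, h₂, hn], fun i j hij => ?_⟩
    fin_cases i <;> fin_cases j <;>
      simp_all [real_inner_comm]
  have hs : ⊤ ≤ Submodule.span ℝ (range ![e₁, e₂, n]) := by
    have hb := (basisOfOrthonormalOfCardEqFinrank ho (by simp)).span_eq
    rw [coe_basisOfOrthonormalOfCardEqFinrank] at hb
    exact hb.ge
  have := (OrthonormalBasis.mk ho hs).sum_inner_mul_inner f W
  rw [← this]
  simp [Fin.sum_univ_three, hf₁, hf₂, hW]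

/-- `M` has two orthonormal tangent vectors at `x`. -/
def HasTangentFrame (M : Set E3) (x : E3) : Prop :=
  ∃ e₁ e₂ : E3, IsTangent M x e₁ ∧ IsTangent M x e₂ ∧ ‖e₁‖ = 1 ∧ ‖e₂‖ = 1 ∧ inner ℝ e₁ e₂ = 0

theorem HasGaussCurvatureAt.hasTangentFrame {M : Set E3} {p : E3} {κ : ℝ}
    (h : HasGaussCurvatureAt M p κ) : HasTangentFrame M p := by
  obtain ⟨U, n, e₁, e₂, -, -, -, h₁, h₂, h₃, h₄, h₅, -⟩ := h
  exact ⟨e₁, e₂, h₁, h₂, h₃, h₄, h₅⟩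

/-- A vector orthogonal to all tangent vectors is orthogonal to the orthogonal complement of the
unit normal. -/
theorem HasTangentFrame.inner_eq_zero {M : Set E3} {x n f W : E3} (h : HasTangentFrame M x)
    (hn : ‖n‖ = 1) (hnt : ∀ v, IsTangent M x v → inner ℝ n v = 0)
    (hf : ∀ v, IsTangent M x v → inner ℝ f v = 0) (hW : inner ℝ n W = 0) :
    inner ℝ f W = 0 := by
  obtain ⟨e₁, e₂, h₁, h₂, h₃, h₄, h₅⟩ := h
  exact inner_eq_zero_of_orthonormal_frame h₃ h₄ h₅ hn (hnt _ h₁) (hnt _ h₂) (hf _ h₁) (hf _ h₂) hW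

/-- The tangent plane of a convex surface does not meet the interior of the body. -/
theorem add_notMem_interior_of_inner_eq_zero {K : Set E3} (hKc : IsClosed K) (hK : Convex ℝ K)
    (hKi : (interior K).Nonempty) {x n W : E3} (hx : x ∈ frontier K)
    (hfr : HasTangentFrame (frontier K) x)
    (hn : ‖n‖ = 1) (hnt : ∀ v, IsTangent (frontier K) x v → inner ℝ n v = 0)
    (hW : inner ℝ n W = 0) : x + W ∉ interior K := by
  -- A supporting functional at `x` is maximal there along every curve in the surface, so it kills
  -- tangent vectors and hence `W`. Its strict inequality on the interior then excludes `x + W`.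
  obtain ⟨f, hf⟩ := geometric_hahn_banach_open_point hK.interior isOpen_interior hx.2
  have hle : ∀ y ∈ K, f y ≤ f x := by
    intro y hy
    have hy' : y ∈ closure (interior K) := by
      rw [hK.closure_interior_eq_closure_of_nonempty_interior hKi]
      exact subset_closure hy
    exact closure_minimal (fun z hz => (hf z hz).le)
      (isClosed_le f.continuous continuous_const) hy'
  set a : E3 := (InnerProductSpace.toDual ℝ E3).symm f with ha
  have haf : ∀ y, inner ℝ a y = f y := fun y => by
    rw [ha, InnerProductSpace.toDual_symm_apply]
  have hat : ∀ v, IsTangent (frontier K) x v → inner ℝ a v = 0 := by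
    rintro v ⟨c, hc, hc0, hcd⟩
    rw [haf]
    refine IsLocalMax.hasDerivAt_eq_zero (f := fun t => f (c t)) (a := 0) ?_ ?_
    · refine Filter.Eventually.of_forall fun t => ?_
      simp only [hc0]
      exact hle _ (hKc.frontier_subset (hc t))
    · exact f.hasFDerivAt.comp_hasDerivAt 0 hcd
  have h0 := hfr.inner_eq_zero hn hnt hat hW
  intro hmem
  have := hf _ hmem
  rw [map_add, ← haf W, h0] at this
  linarith

/-- The metric projection onto a closed convex set: it does not increase distances, and maps the
complement of the interior to the boundary. -/
theorem exists_lipschitz_projection {K : Set E3} (hKc : IsClosed K) (hK : Convex ℝ K)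
    (hne : K.Nonempty) :
    ∃ π : E3 → E3, LipschitzWith 1 π ∧ (∀ x ∈ K, π x = x) ∧
      ∀ x, x ∉ interior K → π x ∈ frontier K := by
  have hex : ∀ u : E3, ∃ v ∈ K, ∀ y ∈ K, inner ℝ (u - v) (y - v) ≤ 0 := by
    intro u
    obtain ⟨v, hv, h⟩ := exists_norm_eq_iInf_of_complete_convex hne hKc.isComplete hK u
    exact ⟨v, hv, (norm_eq_iInf_iff_real_inner_le_zero hK hv).1 h⟩
  choose π hπK hπ using hex
  have hfix : ∀ x ∈ K, π x = x := by
    intro x hx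
    have := hπ x x hx
    rw [real_inner_self_eq_norm_sq] at this
    have h0 : ‖x - π x‖ = 0 := by
      have := sq_nonneg ‖x - π x‖
      exact pow_eq_zero_iff (two_ne_zero) |>.1 (by linarith)
    exact (sub_eq_zero.1 (norm_eq_zero.1 h0)).symm
  refine ⟨π, ?_, hfix, ?_⟩
  · refine LipschitzWith.of_dist_le_mul fun x y => ?_
    rw [NNReal.coe_one, one_mul, dist_eq_norm, dist_eq_norm]
    have h1 := hπ x (π y) (hπK y)
    have h2 := hπ y (π x) (hπK x)
    -- Sum of the two variational inequalities; Cauchy–Schwarz then gives the Lipschitz bound.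
    have h3 : ‖π x - π y‖ ^ 2 ≤ inner ℝ (x - y) (π x - π y) := by
      rw [← real_inner_self_eq_norm_sq]
      have e : inner ℝ (x - y) (π x - π y) - inner ℝ (π x - π y) (π x - π y)
          = - inner ℝ (x - π x) (π y - π x) - inner ℝ (y - π y) (π x - π y) := by
        simp only [inner_sub_left, inner_sub_right]
        ring
      linarith
    have h4 := real_inner_le_norm (x - y) (π x - π y)
    by_contra! hlt
    nlinarith [norm_nonneg (x - y), norm_nonneg (π x - π y)]
  · intro x hx
    refine ⟨subset_closure (hπK x), fun hint => ?_⟩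
    by_cases hxK : x ∈ K
    · rw [hfix x hxK] at hint
      exact hx hint
    · have hne : x - π x ≠ 0 := fun h => hxK (by rw [sub_eq_zero.1 h]; exact hπK x)
      -- If `π x` were interior, a small step from it towards `x` would stay in `K` and violate the
      -- variational inequality.
      have hc : Filter.Tendsto (fun t : ℝ => π x + t • (x - π x)) (𝓝[>] 0) (𝓝 (π x)) := by
        have : Continuous (fun t : ℝ => π x + t • (x - π x)) := by fun_prop
        simpa using (this.tendsto 0).mono_left nhdsWithin_le_nhds
      have hev := hc.eventually (isOpen_interior.mem_nhds hint)
      obtain ⟨t, htK, ht⟩ := (hev.and self_mem_nhdsWithin).exists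
      have h := hπ x _ (interior_subset htK)
      rw [add_sub_cancel_left, real_inner_smul_right, real_inner_self_eq_norm_sq] at h
      have : 0 < ‖x - π x‖ := norm_pos_iff.2 hne
      have ht' : (0 : ℝ) < t := ht
      have : 0 < t * ‖x - π x‖ ^ 2 := by positivity
      linarith

/-! ### Lengths of curves -/

/-- A curve whose speed is bounded by the derivative of `φ` has length at most the increment
of `φ`. -/
theorem eVariationOn_Icc_le_of_norm_deriv_le {f f' : ℝ → E3} {φ φ' : ℝ → ℝ} {a b : ℝ} (hab : a ≤ b)
    (hf : ∀ x ∈ Icc a b, HasDerivAt f (f' x) x) (hφ : ∀ x ∈ Icc a b, HasDerivAt φ (φ' x) x)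
    (hle : ∀ x ∈ Icc a b, ‖f' x‖ ≤ φ' x) :
    eVariationOn f (Icc a b) ≤ ENNReal.ofReal (φ b - φ a) ∧ 0 ≤ φ b - φ a := by
  have key : ∀ x ∈ Icc a b, ∀ y ∈ Icc a b, x ≤ y → ‖f y - f x‖ ≤ φ y - φ x := by
    intro x hx y hy hxy
    have hsub : Icc x y ⊆ Icc a b := Icc_subset_Icc hx.1 hy.2
    refine image_norm_le_of_norm_deriv_right_le_deriv_boundary' (f := fun z => f z - f x)
      (f' := f') (a := x) (b := y) (B := fun z => φ z - φ x) (B' := φ') ?_ ?_ (by simp) ?_ ?_ ?_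
      (right_mem_Icc.2 hxy)
    · exact fun z hz => ((hf z (hsub hz)).sub_const _).continuousAt.continuousWithinAt
    · exact fun z hz => ((hf z (hsub (Ico_subset_Icc_self hz))).sub_const _).hasDerivWithinAt
    · exact fun z hz => ((hφ z (hsub hz)).sub_const _).continuousAt.continuousWithinAt
    · exact fun z hz => ((hφ z (hsub (Ico_subset_Icc_self hz))).sub_const _).hasDerivWithinAt
    · exact fun z hz => hle z (hsub (Ico_subset_Icc_self hz))
  have hmono : MonotoneOn φ (Icc a b) := fun x hx y hy hxy => by
    have := (norm_nonneg _).trans (key x hx y hy hxy)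
    linarith
  refine ⟨?_, sub_nonneg.2 (hmono (left_mem_Icc.2 hab) (right_mem_Icc.2 hab) hab)⟩
  have h1 := hmono.eVariationOn_eq (left_mem_Icc.2 hab) (right_mem_Icc.2 hab)
  rw [inter_self] at h1
  rw [← h1]
  -- Each partition sum of `f` is dominated by that of the monotone `φ`, whose variation is its
  -- increment.
  refine iSup_le fun p => le_trans (Finset.sum_le_sum fun i _ => ?_)
    (le_iSup (fun p : ℕ × { u : ℕ → ℝ // Monotone u ∧ ∀ i, u i ∈ Icc a b } =>
      ∑ i ∈ Finset.range p.1, edist (φ (p.2.1 (i + 1))) (φ (p.2.1 i))) p)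
  rw [edist_dist, edist_dist]
  refine ENNReal.ofReal_le_ofReal ?_
  rw [dist_eq_norm, Real.dist_eq]
  exact (key _ (p.2.2.2 i) _ (p.2.2.2 (i + 1)) (p.2.2.1 (Nat.le_succ i))).trans (le_abs_self _)

/-- A continuous curve outside the interior of a convex body, projected to the boundary, bounds the
intrinsic distance of the projections of its end points. -/
theorem intrinsicEDist_le_eVariationOn {M : Set E3} {π : E3 → E3} (hπ : LipschitzWith 1 π)
    {X : ℝ → E3} {ℓ : ℝ} (hℓ : 0 ≤ ℓ) (hX : ContinuousOn X (Icc 0 ℓ))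
    (hXM : ∀ s ∈ Icc 0 ℓ, π (X s) ∈ M) :
    intrinsicEDist M (π (X 0)) (π (X ℓ)) ≤ eVariationOn X (Icc 0 ℓ) := by
  have hmaps : MapsTo (fun τ : ℝ => ℓ * τ) (Icc 0 1) (Icc 0 ℓ) := fun τ hτ =>
    ⟨mul_nonneg hℓ hτ.1, mul_le_of_le_one_right hℓ hτ.2⟩
  have hc : IsCurveIn M (π (X 0)) (π (X ℓ)) (π ∘ X ∘ fun τ => ℓ * τ) := by
    refine ⟨hπ.continuous.comp_continuousOn (hX.comp (by fun_prop) hmaps),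
      fun τ hτ => hXM _ (hmaps hτ), by simp, by simp⟩
  refine (iInf₂_le _ hc).trans ?_
  have h1 := (hπ.lipschitzOnWith (s := univ)).comp_eVariationOn_le
    (g := X ∘ fun τ => ℓ * τ) (s := Icc 0 1) (mapsTo_univ _ _)
  rw [ENNReal.coe_one, one_mul] at h1
  refine h1.trans (eVariationOn.comp_le_of_monotoneOn X _ ?_ hmaps)
  exact fun x _ y _ hxy => mul_le_mul_of_nonneg_left hxy hℓ

/-! ### Geodesics -/

theorem IsGeodesic.hasDerivAt {M : Set E3} {γ : ℝ → E3} (h : IsGeodesic M γ) (t : ℝ) :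
    HasDerivAt γ (deriv γ t) t :=
  (h.1.differentiable two_ne_zero t).hasDerivAt

theorem IsGeodesic.hasDerivAt_deriv {M : Set E3} {γ : ℝ → E3} (h : IsGeodesic M γ) (t : ℝ) :
    HasDerivAt (deriv γ) (deriv (deriv γ) t) t := by
  have h2 : ContDiff ℝ (1 + 1) γ := by simpa [one_add_one_eq_two] using h.1
  exact ((contDiff_succ_iff_deriv.1 h2).2.2.differentiable one_ne_zero t).hasDerivAt

theorem IsGeodesic.isTangent_smul_deriv {M : Set E3} {γ : ℝ → E3} (h : IsGeodesic M γ) (t a : ℝ) :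
    IsTangent M (γ t) (a • deriv γ t) := by
  refine ⟨fun s => γ (t + a * s), fun s => h.2.1 _, by simp, ?_⟩
  have h1 : HasDerivAt (fun s : ℝ => t + a * s) a 0 := by
    simpa using ((hasDerivAt_id (0 : ℝ)).const_mul a).const_add t
  have h2 : HasDerivAt γ (deriv γ t) (t + a * 0) := by simpa using h.hasDerivAt t
  exact HasDerivAt.scomp (0 : ℝ) h2 h1

theorem IsGeodesic.isTangent_deriv {M : Set E3} {γ : ℝ → E3} (h : IsGeodesic M γ) (t : ℝ) :
    IsTangent M (γ t) (deriv γ t) := by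
  simpa using h.isTangent_smul_deriv t 1

/-- Geodesics have constant speed. -/
theorem IsGeodesic.norm_deriv_eq {M : Set E3} {γ : ℝ → E3} (h : IsGeodesic M γ) (t : ℝ) :
    ‖deriv γ t‖ = ‖deriv γ 0‖ := by
  have hd : ∀ s, HasDerivAt (fun s => inner ℝ (deriv γ s) (deriv γ s)) 0 s := by
    intro s
    have h1 := (h.hasDerivAt_deriv s).inner ℝ (h.hasDerivAt_deriv s)
    have h0 := h.2.2 s _ (h.isTangent_deriv s)
    rw [real_inner_comm (deriv (deriv γ) s), h0, add_zero] at h1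
    exact h1
  have := is_const_of_deriv_eq_zero (fun s => (hd s).differentiableAt) (fun s => (hd s).deriv) t 0
  simp only [real_inner_self_eq_norm_sq] at this
  exact (sq_eq_sq₀ (norm_nonneg _) (norm_nonneg _)).1 this

/-- Reparametrization of a geodesic by a linear change of parameter. -/
theorem IsGeodesic.comp_mul {M : Set E3} {γ : ℝ → E3} (h : IsGeodesic M γ) (a : ℝ) :
    IsGeodesic M (fun s => γ (a * s)) ∧ deriv (fun s => γ (a * s)) 0 = a • deriv γ 0 := by
  have hm : ∀ s : ℝ, HasDerivAt (fun s : ℝ => a * s) a s := fun s => by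
    simpa using (hasDerivAt_id s).const_mul a
  have h1 : ∀ s, HasDerivAt (fun s => γ (a * s)) (a • deriv γ (a * s)) s := fun s =>
    HasDerivAt.scomp s (h.hasDerivAt (a * s)) (hm s)
  have h1' : deriv (fun s => γ (a * s)) = fun s => a • deriv γ (a * s) :=
    funext fun s => (h1 s).deriv
  have h2 : ∀ s, HasDerivAt (fun s => a • deriv γ (a * s)) (a • a • deriv (deriv γ) (a * s)) s :=
    fun s => (HasDerivAt.scomp s (h.hasDerivAt_deriv (a * s)) (hm s)).const_smul a
  refine ⟨⟨h.1.comp (by fun_prop), fun s => h.2.1 _, fun s v hv => ?_⟩, by simp [h1']⟩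
  rw [h1', (h2 s).deriv, real_inner_smul_left, real_inner_smul_left, h.2.2 _ v hv]
  simp

theorem IsGeodesic.isExp_smul {M : Set E3} {γ : ℝ → E3} (h : IsGeodesic M γ) (a : ℝ) :
    IsExp M (γ 0) (a • deriv γ 0) (γ a) :=
  ⟨_, (h.comp_mul a).1, by simp, (h.comp_mul a).2, by simp⟩

/-! ### First variation of the length -/

/-- A tangential variation field along the beginning of a geodesic, with a given initial value and
vanishing at the end, and the first variation of the length. -/
theorem IsGeodesic.exists_variation {M U : Set E3} {γ : ℝ → E3} {n : E3 → E3} {v : E3} {ℓ : ℝ}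
    (h : IsGeodesic M γ) (hspeed : ‖deriv γ 0‖ = 1) (hfr : ∀ x ∈ M, HasTangentFrame M x)
    (hU : IsOpen U) (h0U : γ 0 ∈ U) (hn : IsUnitNormalField M U n)
    (hv : inner ℝ (n (γ 0)) v = 0) (hℓ : 0 < ℓ) :
    ∃ (δ C : ℝ) (W : ℝ → E3), 0 < δ ∧ δ ≤ ℓ ∧ W 0 = v ∧ W δ = 0 ∧ ContinuousOn W (Icc 0 δ) ∧
      (∀ s ∈ Icc 0 δ, γ s ∈ U ∧ inner ℝ (n (γ s)) (W s) = 0) ∧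
      ∀ t : ℝ,
        eVariationOn (fun s => γ s + t • W s) (Icc 0 δ)
          ≤ ENNReal.ofReal (δ - t * inner ℝ (deriv γ 0) v + C * t ^ 2) ∧
        0 ≤ δ - t * inner ℝ (deriv γ 0) v + C * t ^ 2 := by
  have hγc : Continuous γ := h.1.continuous
  have hJ : IsOpen (γ ⁻¹' U) := hU.preimage hγc
  obtain ⟨ε, hε, hball⟩ := Metric.isOpen_iff.1 hJ 0 h0U
  -- The normal field is only local, so the variation is confined to a piece of the geodesic lying
  -- in `U`.
  set δ := min (ε / 2) ℓ with hδdef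
  have hδ : 0 < δ := lt_min (by positivity) hℓ
  have hIJ : Icc 0 δ ⊆ γ ⁻¹' U := fun s hs => hball (by
    rw [Metric.mem_ball, Real.dist_eq, sub_zero, abs_of_nonneg hs.1]
    have := hs.2.trans (min_le_left _ _)
    linarith)
  set n₀ := n (γ 0) with hn₀
  have hn₀1 : ‖n₀‖ = 1 := (hn.2 _ ⟨h.2.1 0, h0U⟩).1
  -- Up to the cutoff this is the double cross product `n × (v × n₀)`: automatically orthogonal to
  -- `n`, of class `C¹`, and equal to `v` at `s = 0`.
  set W : ℝ → E3 := fun s =>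
    (1 - s / δ) • (inner ℝ n₀ (n (γ s)) • v - inner ℝ (n (γ s)) v • n₀) with hW
  have hWc : ContDiffOn ℝ 1 W (γ ⁻¹' U) := by
    have hN : ContDiffOn ℝ 1 (fun s => n (γ s)) (γ ⁻¹' U) :=
      hn.1.comp (h.1.of_le one_le_two).contDiffOn (fun s hs => hs)
    have h1 : ContDiffOn ℝ 1 (fun s : ℝ => 1 - s / δ) (γ ⁻¹' U) := by fun_prop
    exact h1.smul (((contDiffOn_const.inner ℝ hN).smul contDiffOn_const).sub
      ((hN.inner ℝ contDiffOn_const).smul contDiffOn_const))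
  have hW' : ∀ s ∈ Icc 0 δ, HasDerivAt W (deriv W s) s := fun s hs =>
    ((hWc.differentiableOn one_ne_zero).differentiableAt (hJ.mem_nhds (hIJ hs))).hasDerivAt
  have hWn : ∀ s, inner ℝ (n (γ s)) (W s) = 0 := by
    intro s
    simp only [hW, real_inner_smul_right, inner_sub_right]
    rw [real_inner_comm (n (γ s)) n₀]
    ring
  have hW0 : W 0 = v := by
    have : inner ℝ n₀ n₀ = (1 : ℝ) := by rw [real_inner_self_eq_norm_sq, hn₀1, one_pow]
    simp only [hW, ← hn₀, this, hv]
    simp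
  have hWδ : W δ = 0 := by simp [hW, div_self hδ.ne']
  obtain ⟨B, hB⟩ := isCompact_Icc.exists_bound_of_continuousOn
    ((hWc.continuousOn_deriv_of_isOpen hJ le_rfl).mono hIJ)
  refine ⟨δ, B ^ 2 / 2 * δ, W, hδ, min_le_right _ _, hW0, hWδ, hWc.continuousOn.mono hIJ,
    fun s hs => ⟨hIJ hs, hWn s⟩, fun t => ?_⟩
  have hX : ∀ s ∈ Icc 0 δ, HasDerivAt (fun s => γ s + t • W s) (deriv γ s + t • deriv W s) s :=
    fun s hs => (h.hasDerivAt s).add ((hW' s hs).const_smul t)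
  -- Since `γ''` is normal and `W` tangential, `⟨γ', W'⟩` is the derivative of `⟨γ', W⟩`, so only
  -- end-point values survive.
  have hφ : ∀ s ∈ Icc 0 δ, HasDerivAt
      (fun s => s + t * inner ℝ (deriv γ s) (W s) + B ^ 2 / 2 * t ^ 2 * s)
      (1 + t * inner ℝ (deriv γ s) (deriv W s) + B ^ 2 / 2 * t ^ 2) s := by
    intro s hs
    have hi := (h.hasDerivAt_deriv s).inner ℝ (hW' s hs)
    have hz : inner ℝ (deriv (deriv γ) s) (W s) = 0 :=
      (hfr _ (h.2.1 s)).inner_eq_zero (hn.2 _ ⟨h.2.1 s, hIJ hs⟩).1 (hn.2 _ ⟨h.2.1 s, hIJ hs⟩).2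
        (h.2.2 s) (hWn s)
    rw [hz, add_zero] at hi
    have hsum := ((hasDerivAt_id s).add (hi.const_mul t)).add
      ((hasDerivAt_id s).const_mul (B ^ 2 / 2 * t ^ 2))
    rw [mul_one] at hsum
    exact hsum
  have hle : ∀ s ∈ Icc 0 δ, ‖deriv γ s + t • deriv W s‖ ≤
      1 + t * inner ℝ (deriv γ s) (deriv W s) + B ^ 2 / 2 * t ^ 2 := by
    intro s hs
    have h1 : ‖deriv γ s‖ = 1 := by rw [h.norm_deriv_eq, hspeed]
    have h2 : ‖deriv γ s + t • deriv W s‖ ^ 2 =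
        1 + 2 * (t * inner ℝ (deriv γ s) (deriv W s)) + t ^ 2 * ‖deriv W s‖ ^ 2 := by
      rw [norm_add_sq_real, h1, real_inner_smul_right, norm_smul, mul_pow, Real.norm_eq_abs, sq_abs]
      ring
    have h3 : ‖deriv W s‖ ^ 2 ≤ B ^ 2 := pow_le_pow_left₀ (norm_nonneg _) (hB s hs) 2
    have h4 : t ^ 2 * ‖deriv W s‖ ^ 2 ≤ t ^ 2 * B ^ 2 := mul_le_mul_of_nonneg_left h3 (sq_nonneg t)
    -- Uses `‖x‖ ≤ (1 + ‖x‖²) / 2`, which is where the factor `B² / 2` comes from.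
    nlinarith [sq_nonneg (‖deriv γ s + t • deriv W s‖ - 1)]
  have hfin := eVariationOn_Icc_le_of_norm_deriv_le hδ.le hX hφ hle
  have heq : δ + t * inner ℝ (deriv γ δ) (W δ) + B ^ 2 / 2 * t ^ 2 * δ
      - (0 + t * inner ℝ (deriv γ 0) (W 0) + B ^ 2 / 2 * t ^ 2 * 0)
      = δ - t * inner ℝ (deriv γ 0) v + B ^ 2 / 2 * δ * t ^ 2 := by
    rw [hWδ, hW0, inner_zero_right]
    ring
  simp only [heq] at hfin
  exact hfin

/-- First variation inequality for the intrinsic distance on the boundary of a convex body. -/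
theorem IsGeodesic.exists_intrinsicDist_le {K U : Set E3} {γ : ℝ → E3} {n π : E3 → E3} {v : E3}
    {ℓ : ℝ} (hKc : IsClosed K) (hK : Convex ℝ K) (hKi : (interior K).Nonempty)
    (hπL : LipschitzWith 1 π) (hπK : ∀ x ∈ K, π x = x)
    (hπf : ∀ x, x ∉ interior K → π x ∈ frontier K)
    (h : IsGeodesic (frontier K) γ) (hspeed : ‖deriv γ 0‖ = 1)
    (hfr : ∀ x ∈ frontier K, HasTangentFrame (frontier K) x)
    (hU : IsOpen U) (h0U : γ 0 ∈ U) (hn : IsUnitNormalField (frontier K) U n)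
    (hv : inner ℝ (n (γ 0)) v = 0) (hℓ : 0 < ℓ) :
    ∃ C : ℝ, ∀ t : ℝ, intrinsicDist (frontier K) (π (γ 0 + t • v)) (γ ℓ)
      ≤ ℓ - t * inner ℝ (deriv γ 0) v + C * t ^ 2 := by
  obtain ⟨δ, C, W, hδ, hδℓ, hW0, hWδ, hWc, hWn, hlen⟩ :=
    h.exists_variation hspeed hfr hU h0U hn hv hℓ
  refine ⟨C, fun t => ?_⟩
  obtain ⟨hl, hl0⟩ := hlen t
  -- The two pieces fit together because `W δ = 0`.
  set X : ℝ → E3 := fun s => if s ≤ δ then γ s + t • W s else γ s with hX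
  have hX1 : EqOn X (fun s => γ s + t • W s) (Icc 0 δ) := fun s hs => by simp [hX, hs.2]
  have hX2 : EqOn X γ (Icc δ ℓ) := fun s hs => by
    rcases hs.1.eq_or_lt with rfl | hlt
    · simp [hX, hWδ]
    · simp [hX, not_le.2 hlt]
  have hγc : Continuous γ := h.1.continuous
  have hXc : ContinuousOn X (Icc 0 ℓ) := by
    rw [← Icc_union_Icc_eq_Icc hδ.le hδℓ]
    refine ContinuousOn.union_of_isClosed ?_ ?_ isClosed_Icc isClosed_Icc
    · exact (hγc.continuousOn.add (hWc.const_smul t)).congr hX1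
    · exact hγc.continuousOn.congr hX2
  have hXf : ∀ s ∈ Icc 0 ℓ, π (X s) ∈ frontier K := by
    intro s hs
    apply hπf
    rcases le_total s δ with hsδ | hsδ
    · rw [hX1 ⟨hs.1, hsδ⟩]
      obtain ⟨hsU, hsn⟩ := hWn s ⟨hs.1, hsδ⟩
      obtain ⟨hn1, hnt⟩ := hn.2 _ ⟨h.2.1 s, hsU⟩
      exact add_notMem_interior_of_inner_eq_zero hKc hK hKi (h.2.1 s) (hfr _ (h.2.1 s)) hn1 hnt
        (by rw [real_inner_smul_right, hsn, mul_zero])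
    · rw [hX2 ⟨hsδ, hs.2⟩]
      exact (h.2.1 s).2
  have h2 : eVariationOn γ (Icc δ ℓ) ≤ ENNReal.ofReal (ℓ - δ) :=
    (eVariationOn_Icc_le_of_norm_deriv_le (φ := fun s => s) (φ' := fun _ => 1) hδℓ
      (fun s _ => h.hasDerivAt s) (fun s _ => hasDerivAt_id s)
      (fun s _ => by rw [h.norm_deriv_eq, hspeed])).1
  have h3 : eVariationOn X (Icc 0 ℓ) = eVariationOn X (Icc 0 δ) + eVariationOn X (Icc δ ℓ) := by
    have := eVariationOn.Icc_add_Icc X (s := univ) hδ.le hδℓ (mem_univ _)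
    simpa only [univ_inter] using this.symm
  have h4 := intrinsicEDist_le_eVariationOn hπL hℓ.le hXc hXf
  have hX0 : X 0 = γ 0 + t • v := by simp [hX, hδ.le, hW0]
  have hXℓ : π (X ℓ) = γ ℓ := by
    rw [hX2 (right_mem_Icc.2 hδℓ)]
    exact hπK _ (hKc.frontier_subset (h.2.1 ℓ))
  rw [hX0, hXℓ, h3, eVariationOn.eq_of_eqOn hX1, eVariationOn.eq_of_eqOn hX2] at h4
  have h5 := h4.trans (add_le_add hl h2)
  rw [← ENNReal.ofReal_add hl0 (sub_nonneg.2 hδℓ)] at h5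
  have h6 := ENNReal.toReal_le_of_le_ofReal (add_nonneg hl0 (sub_nonneg.2 hδℓ)) h5
  unfold intrinsicDist
  linarith

/-! ### The balance of the weighted directions -/

/-- Each vertex begins a boundary arc, and boundary points are not relatively interior. This makes
the geodesics to the vertices have positive length, as the first variation requires. -/
theorem IsConvexQuadrilateral.ne_vertex {M Q : Set E3} {V : Fin 4 → E3} {P : E3}
    (hQ : IsConvexQuadrilateral M V Q) (hP : IsInteriorPoint M Q P) (i : Fin 4) : P ≠ V i := by
  rintro rfl
  obtain ⟨S, hS, -, -, hb⟩ := hQ.boundary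
  have : V i ∈ ⋃ i, S i := by
    obtain ⟨c, hc, hSc, -⟩ := hS i
    refine mem_iUnion.2 ⟨i, ?_⟩
    rw [hSc, ← hc.2.2.1]
    exact mem_image_of_mem _ (left_mem_Icc.2 zero_le_one)
  rw [← hb] at this
  exact this.2 hP.2

/-- At an interior weighted Fermat-Torricelli point the weighted directions balance. -/
theorem sum_smul_direction_eq_zero {M Q : Set E3} (hM : IsConvexSurface M) {V : Fin 4 → E3}
    (hQ : IsConvexQuadrilateral M V Q) {w : Fin 4 → ℝ} (hw : ∀ i, 0 < w i) {P : E3}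
    (hP : IsInteriorPoint M Q P) (hmin : IsFermatTorricelliPoint M Q V w P)
    {γ : Fin 4 → ℝ → E3} (hγ : ∀ i, IsGeodesicTo M P (V i) (γ i)) :
    ∑ i, w i • deriv (γ i) 0 = 0 := by
  obtain ⟨K, hKc, hK, hKi, rfl⟩ := hM.boundary
  obtain ⟨K₁, K₂, -, hcurv⟩ := hM.curvature
  have hfr : ∀ x ∈ frontier K, HasTangentFrame (frontier K) x := fun x hx => by
    obtain ⟨κ, hκ, -⟩ := hcurv x hx
    exact hκ.hasTangentFrame
  have hPM : P ∈ frontier K := hQ.subset hP.1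
  obtain ⟨κ, ⟨U, n, -, -, hU, hPU, hn, -⟩, -⟩ := hcurv P hPM
  obtain ⟨hn1, hnt⟩ := hn.2 _ ⟨hPM, hPU⟩
  obtain ⟨π, hπL, hπK, hπf⟩ := exists_lipschitz_projection hKc hK (hKi.mono interior_subset)
  set v : E3 := ∑ i, w i • deriv (γ i) 0 with hvdef
  have hnv : inner ℝ (n P) v = 0 := by
    rw [hvdef, inner_sum]
    refine Finset.sum_eq_zero fun i _ => hnt _ ?_
    have := (hγ i).1.isTangent_smul_deriv 0 (w i)
    rwa [(hγ i).2.1] at this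
  have hC : ∀ i, ∃ C : ℝ, ∀ t : ℝ, intrinsicDist (frontier K) (π (P + t • v)) (V i)
      ≤ intrinsicDist (frontier K) P (V i) - t * inner ℝ (deriv (γ i) 0) v + C * t ^ 2 := by
    intro i
    obtain ⟨hg, h0, hs, hℓ⟩ := hγ i
    have hpos : 0 < intrinsicDist (frontier K) P (V i) := by
      refine lt_of_le_of_ne ENNReal.toReal_nonneg fun h => hQ.ne_vertex hP i ?_
      rw [← hℓ, ← h, h0]
    obtain ⟨C, hC⟩ := hg.exists_intrinsicDist_le hKc hK hKi hπL hπK hπf hs hfr hU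
      (h0.symm ▸ hPU) hn (h0.symm ▸ hnv) hpos
    rw [h0, hℓ] at hC
    exact ⟨C, hC⟩
  choose C hC using hC
  have hmem : ∀ t : ℝ, π (P + t • v) ∈ frontier K := fun t =>
    hπf _ (add_notMem_interior_of_inner_eq_zero hKc hK hKi hPM (hfr _ hPM) hn1 hnt
      (by rw [real_inner_smul_right, hnv, mul_zero]))
  have htend : Filter.Tendsto (fun t : ℝ => π (P + t • v)) (𝓝[>] 0) (𝓝[frontier K] P) := by
    refine tendsto_nhdsWithin_iff.2 ⟨?_, Filter.Eventually.of_forall hmem⟩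
    have hc : Continuous (fun t : ℝ => π (P + t • v)) := hπL.continuous.comp (by fun_prop)
    have := hc.tendsto 0
    rw [zero_smul, add_zero, hπK P (hKc.frontier_subset hPM)] at this
    exact this.mono_left nhdsWithin_le_nhds
  -- For small `t > 0` the displaced point is still in `Q`, so minimality gives `t‖v‖² ≤ C t²`;
  -- divide by `t` and let `t → 0`.
  have hineq : ∀ᶠ t : ℝ in 𝓝[>] 0, ‖v‖ ^ 2 ≤ (∑ i, w i * C i) * t := by
    filter_upwards [htend.eventually hP.2, self_mem_nhdsWithin] with t htQ ht
    have ht' : (0 : ℝ) < t := ht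
    have h1 := hmin.2 _ htQ
    have h2 := Finset.sum_le_sum fun i (_ : i ∈ Finset.univ) =>
      mul_le_mul_of_nonneg_left (hC i t) (hw i).le
    have h3 : ∑ i, w i * (intrinsicDist (frontier K) P (V i)
        - t * inner ℝ (deriv (γ i) 0) v + C i * t ^ 2)
        = ∑ i, w i * intrinsicDist (frontier K) P (V i) - t * ‖v‖ ^ 2
          + (∑ i, w i * C i) * t ^ 2 := by
      have : ‖v‖ ^ 2 = ∑ i, w i * inner ℝ (deriv (γ i) 0) v := by
        rw [← real_inner_self_eq_norm_sq]
        conv_lhs => rw [hvdef, sum_inner]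
        simp only [real_inner_smul_left]
        rfl
      rw [this, Finset.mul_sum, Finset.sum_mul, ← Finset.sum_sub_distrib, ← Finset.sum_add_distrib]
      exact Finset.sum_congr rfl fun i _ => by ring
    rw [h3] at h2
    have h4 : t * ‖v‖ ^ 2 ≤ t * ((∑ i, w i * C i) * t) := by nlinarith
    exact le_of_mul_le_mul_left h4 ht'
  have hlim : Filter.Tendsto (fun t : ℝ => (∑ i, w i * C i) * t) (𝓝[>] 0) (𝓝 0) := by
    have : Continuous (fun t : ℝ => (∑ i, w i * C i) * t) := by fun_prop
    simpa using (this.tendsto 0).mono_left nhdsWithin_le_nhds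
  have h0 : ‖v‖ ^ 2 ≤ 0 := ge_of_tendsto hlim hineq
  have : ‖v‖ ^ 2 = 0 := le_antisymm h0 (sq_nonneg _)
  simpa using this

/-! ### Parallelograms -/

/-- Reflecting alternate vertices turns the difference of opposite sides into the sum of all four
vectors. Class B reflects the other pair and only changes the overall sign. -/
theorem isParallelogram_iff_sum_eq_zero (T : Fin 4 → E3) :
    IsParallelogram (-T 0) (T 1) (-T 2) (T 3) ↔ ∑ i, T i = 0 := by
  rw [IsParallelogram, Fin.sum_univ_four, ← sub_eq_zero]
  have : T 1 - -T 0 - (-T 2 - T 3) = T 0 + T 1 + T 2 + T 3 := by abel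
  rw [this]

theorem isParallelogram_neg_iff_sum_eq_zero (T : Fin 4 → E3) :
    IsParallelogram (T 0) (-T 1) (T 2) (-T 3) ↔ ∑ i, T i = 0 := by
  rw [IsParallelogram, Fin.sum_univ_four, ← sub_eq_zero, ← neg_eq_zero]
  have : -(-T 1 - T 0 - (T 2 - -T 3)) = T 0 + T 1 + T 2 + T 3 := by abel
  rw [this]

theorem orientedSin_eq (ν u v : E3) : orientedSin ν u v =
    ν 0 * (u 1 * v 2 - u 2 * v 1) - ν 1 * (u 0 * v 2 - u 2 * v 0)
      + ν 2 * (u 0 * v 1 - u 1 * v 0) := by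
  simp [orientedSin, Matrix.det_fin_three]
  ring

/-- Pairing a relation `s u + t v = 0` with `v × ν` and with `ν × u` multiplies `s` and `t` by the
determinant. -/
theorem linearIndependent_pair_of_orientedSin_ne_zero {ν u v : E3} (h : orientedSin ν u v ≠ 0) :
    LinearIndependent ℝ ![u, v] := by
  rw [LinearIndependent.pair_iff]
  intro s t hst
  have hc : ∀ j, s * u j + t * v j = 0 := fun j => by
    simpa using congrArg (fun x : E3 => x j) hst
  rw [orientedSin_eq] at h
  have e0 := hc 0
  have e1 := hc 1
  have e2 := hc 2
  constructor
  · refine (mul_eq_zero.1 ?_).resolve_right h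
    linear_combination (ν 1 * (-v 2) + ν 2 * v 1) * e0 + (ν 0 * v 2 - ν 2 * v 0) * e1
      + (ν 1 * v 0 - ν 0 * v 1) * e2
  · refine (mul_eq_zero.1 ?_).resolve_right h
    linear_combination (ν 1 * u 2 - ν 2 * u 1) * e0 + (ν 2 * u 0 - ν 0 * u 2) * e1
      + (ν 0 * u 1 - ν 1 * u 0) * e2

/-- Balanced weighted directions in counterclockwise order span a nondegenerate parallelogram. -/
theorem linearIndependent_add_add_of_counterclockwise {u : Fin 4 → E3} {w : Fin 4 → ℝ} {ν : E3}
    (hw : ∀ i, 0 < w i) (hsum : ∑ i, w i • u i = 0)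
    (hccw : ∀ i, 0 < orientedSin ν (u i) (u (i + 1))) :
    LinearIndependent ℝ ![w 1 • u 1 + w 0 • u 0, w 3 • u 3 + w 0 • u 0] := by
  apply linearIndependent_pair_of_orientedSin_ne_zero (ν := ν)
  have h1 := hccw 1
  have h3 := hccw 3
  -- With `T i = w i • u i` and `[·,·]` the determinant with `ν`, the left side is `[T 1, T 3 + T 0]
  -- + [T 0, T 3]`, and the balance gives `T 3 + T 0 = -(T 1 + T 2)`.
  have key : orientedSin ν (w 1 • u 1 + w 0 • u 0) (w 3 • u 3 + w 0 • u 0)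
      = -(w 1 * w 2 * orientedSin ν (u 1) (u (1 + 1)))
        - w 3 * w 0 * orientedSin ν (u 3) (u (3 + 1)) := by
    have hc : ∀ j, w 0 * u 0 j + w 1 * u 1 j + w 2 * u 2 j + w 3 * u 3 j = 0 := fun j => by
      simpa [Fin.sum_univ_four] using congrArg (fun x : E3 => x j) hsum
    have e0 := hc 0
    have e1 := hc 1
    have e2 := hc 2
    rw [show (1 + 1 : Fin 4) = 2 from rfl, show (3 + 1 : Fin 4) = 0 from rfl]
    simp only [orientedSin_eq, PiLp.add_apply, PiLp.smul_apply, smul_eq_mul]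
    linear_combination w 1 * (-ν 1 * (-u 1 2) - ν 2 * u 1 1) * e0
      + w 1 * (-ν 0 * u 1 2 + ν 2 * u 1 0) * e1 + w 1 * (ν 0 * u 1 1 - ν 1 * u 1 0) * e2
  rw [key]
  have a1 : 0 < w 1 * w 2 * orientedSin ν (u 1) (u (1 + 1)) :=
    mul_pos (mul_pos (hw 1) (hw 2)) h1
  have a3 : 0 < w 3 * w 0 * orientedSin ν (u 3) (u (3 + 1)) :=
    mul_pos (mul_pos (hw 3) (hw 0)) h3
  linarith

/-! ### Plasticity -/

/-- Three vectors of a plane are linearly dependent. -/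
theorem exists_isTriangleWeights {n a b c : E3} (hn : n ≠ 0) (ha : inner ℝ n a = 0)
    (hb : inner ℝ n b = 0) (hc : inner ℝ n c = 0) : ∃ p, IsTriangleWeights a b c p := by
  by_contra! hno
  have hli : LinearIndependent ℝ ![a, b, c] := by
    rw [Fintype.linearIndependent_iff]
    intro g hg
    by_contra! hne
    obtain ⟨i, hi⟩ := hne
    refine hno g ⟨fun h => hi (by simp [h]), ?_⟩
    simpa [Fin.sum_univ_three] using hg
  -- Three independent vectors would span the space, yet all lie in the plane orthogonal to `n`.
  have hspan := hli.span_eq_top_of_card_eq_finrank (by simp)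
  have hle : Submodule.span ℝ (range ![a, b, c]) ≤ (Submodule.span ℝ {n})ᗮ := by
    rw [Submodule.span_le]
    rintro _ ⟨i, rfl⟩
    rw [SetLike.mem_coe, Submodule.mem_orthogonal_singleton_iff_inner_right]
    fin_cases i <;> simpa
  rw [hspan] at hle
  have := Submodule.mem_orthogonal_singleton_iff_inner_right.1 (hle (Submodule.mem_top (x := n)))
  exact hn (inner_self_eq_zero.1 this)

/-- Otherwise the relation would involve only the independent pair. This keeps the denominators of
the plasticity ratios nonzero. -/
theorem IsTriangleWeights.ne_zero_right {a b c : E3} {p : Fin 3 → ℝ} (h : IsTriangleWeights a b c p)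
    (hli : LinearIndependent ℝ ![a, b]) : p 2 ≠ 0 := by
  intro h2
  have h' := h.2
  rw [h2, zero_smul, add_zero] at h'
  obtain ⟨h0, h1⟩ := LinearIndependent.pair_iff.1 hli _ _ h'
  exact h.1 (by ext i; fin_cases i <;> simp [h0, h1, h2])

theorem IsTriangleWeights.ne_zero_left {a b c : E3} {p : Fin 3 → ℝ} (h : IsTriangleWeights a b c p)
    (hli : LinearIndependent ℝ ![b, c]) : p 0 ≠ 0 := by
  intro h0
  have h' := h.2
  rw [h0, zero_smul, zero_add] at h'
  obtain ⟨h1, h2⟩ := LinearIndependent.pair_iff.1 hli _ _ h'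
  exact h.1 (by ext i; fin_cases i <;> simp [h0, h1, h2])

/-- For fixed weights of the three triangles, the two plasticity equations express the balance of
the weighted directions. -/
theorem plasticity_iff_sum_eq_zero {u : Fin 4 → E3} {w : Fin 4 → ℝ} {p q r : Fin 3 → ℝ}
    (hw0 : w 0 ≠ 0) (h01 : LinearIndependent ℝ ![u 0, u 1]) (h12 : LinearIndependent ℝ ![u 1, u 2])
    (h02 : LinearIndependent ℝ ![u 0, u 2]) (hp : IsTriangleWeights (u 0) (u 1) (u 2) p)
    (hq : IsTriangleWeights (u 0) (u 2) (u 3) q) (hr : IsTriangleWeights (u 0) (u 1) (u 3) r) :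
    (w 1 / w 0 = p 1 / p 0 * (1 - w 3 / w 0 * (q 0 / q 2)) ∧
      w 2 / w 0 = p 2 / p 0 * (1 - w 3 / w 0 * (r 0 / r 2))) ↔ ∑ i, w i • u i = 0 := by
  have hp0 := hp.ne_zero_left h12
  have hq2 := hq.ne_zero_right h02
  have hr2 := hr.ne_zero_right h01
  have e0 : u 0 = (-(p 1 / p 0)) • u 1 + (-(p 2 / p 0)) • u 2 := by
    have : p 0 • (u 0 - ((-(p 1 / p 0)) • u 1 + (-(p 2 / p 0)) • u 2)) = 0 := by
      rw [← hp.2]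
      match_scalars <;> field_simp
    exact sub_eq_zero.1 ((smul_eq_zero.1 this).resolve_left hp0)
  have e3q : u 3 = (-(q 0 / q 2)) • u 0 + (-(q 1 / q 2)) • u 2 := by
    have : q 2 • (u 3 - ((-(q 0 / q 2)) • u 0 + (-(q 1 / q 2)) • u 2)) = 0 := by
      rw [← hq.2]
      match_scalars <;> field_simp
    exact sub_eq_zero.1 ((smul_eq_zero.1 this).resolve_left hq2)
  have e3r : u 3 = (-(r 0 / r 2)) • u 0 + (-(r 1 / r 2)) • u 1 := by
    have : r 2 • (u 3 - ((-(r 0 / r 2)) • u 0 + (-(r 1 / r 2)) • u 1)) = 0 := by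
      rw [← hr.2]
      match_scalars <;> field_simp
    exact sub_eq_zero.1 ((smul_eq_zero.1 this).resolve_left hr2)
  generalize p 1 / p 0 = a at *
  generalize p 2 / p 0 = b at *
  generalize q 0 / q 2 = c at *
  generalize q 1 / q 2 = c' at *
  generalize r 0 / r 2 = d at *
  generalize r 1 / r 2 = d' at *
  -- The triangles `ACD` and `ABD` give two expressions for `u 3`; comparing coordinates makes them
  -- compatible.
  have hcd : c * a = d * a - d' ∧ c * b - c' = d * b := by
    have : (c * a - (d * a - d')) • u 1 + (c * b - c' - d * b) • u 2 = 0 := by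
      have := e3q.symm.trans e3r
      rw [e0, ← sub_eq_zero] at this
      rw [← this]
      module
    obtain ⟨h1, h2⟩ := LinearIndependent.pair_iff.1 h12 _ _ this
    exact ⟨by linarith, by linarith⟩
  -- The coordinates of the sum are the two plasticity equations with `w 0` cleared. Compatibility
  -- lets the second be written with `d` instead of `c` and `c'`.
  have hs : ∑ i, w i • u i
      = (w 1 - a * (w 0 - w 3 * c)) • u 1 + (w 2 - b * (w 0 - w 3 * d)) • u 2 := by
    rw [Fin.sum_univ_four, e3q, e0]
    have : w 2 - b * (w 0 - w 3 * d) = w 2 - b * w 0 + w 3 * (c * b - c') := by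
      rw [hcd.2]; ring
    rw [this]
    module
  have hA : w 1 / w 0 = a * (1 - w 3 / w 0 * c) ↔ w 1 - a * (w 0 - w 3 * c) = 0 := by
    rw [sub_eq_zero]
    field_simp
  have hB : w 2 / w 0 = b * (1 - w 3 / w 0 * d) ↔ w 2 - b * (w 0 - w 3 * d) = 0 := by
    rw [sub_eq_zero]
    field_simp
  rw [hA, hB, hs]
  constructor
  · rintro ⟨h1, h2⟩
    rw [h1, h2, zero_smul, zero_smul, add_zero]
  · exact fun h => LinearIndependent.pair_iff.1 h12 _ _ h

/-- Weights satisfy the plasticity equations if and only if the weighted directions balance. -/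
theorem plasticityEquations_iff_sum_eq_zero {n : E3} (hn : n ≠ 0) {u : Fin 4 → E3}
    (hnu : ∀ i, inner ℝ n (u i) = 0) {w : Fin 4 → ℝ} (hw0 : w 0 ≠ 0) {c : ℝ} (hc : ∑ i, w i = c)
    (h01 : LinearIndependent ℝ ![u 0, u 1]) (h12 : LinearIndependent ℝ ![u 1, u 2])
    (h02 : LinearIndependent ℝ ![u 0, u 2]) :
    PlasticityEquations u c w ↔ ∑ i, tangentPoint u w i = 0 := by
  constructor
  · rintro ⟨-, h⟩
    -- The equations quantify over all triangle weights, so some must be exhibited before they say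
    -- anything.
    obtain ⟨p, hp⟩ := exists_isTriangleWeights hn (hnu 0) (hnu 1) (hnu 2)
    obtain ⟨q, hq⟩ := exists_isTriangleWeights hn (hnu 0) (hnu 2) (hnu 3)
    obtain ⟨r, hr⟩ := exists_isTriangleWeights hn (hnu 0) (hnu 1) (hnu 3)
    exact (plasticity_iff_sum_eq_zero hw0 h01 h12 h02 hp hq hr).1 (h p q r hp hq hr)
  · exact fun h => ⟨hc, fun p q r hp hq hr =>
      (plasticity_iff_sum_eq_zero hw0 h01 h12 h02 hp hq hr).2 h⟩

theorem theorem4p1 (M : Set E3) (hM : IsConvexSurface M)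
    (V : Fin 4 → E3) (Q : Set E3) (hQ : IsConvexQuadrilateral M V Q)
    (w : Fin 4 → ℝ) (hw : ∀ i, 0 < w i)
    (P : E3) (hP : IsInteriorPoint M Q P) (hmin : IsFermatTorricelliPoint M Q V w P)
    (γ : Fin 4 → ℝ → E3) (hγ : ∀ i, IsGeodesicTo M P (V i) (γ i))
    (u : Fin 4 → E3) (hu : ∀ i, u i = deriv (γ i) 0)
    (T : Fin 4 → E3) (hT : T = tangentPoint u w) :
    -- the points of the tangent plane, and their images on the four geodesics
    (∀ i, IsTangent M P (T i) ∧ ‖T i‖ = w i ∧ IsExp M P (T i) (γ i (w i))) ∧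
    -- Class A and Class B
    IsParallelogram (-T 0) (T 1) (-T 2) (T 3) ∧
    IsParallelogram (T 0) (-T 1) (T 2) (-T 3) ∧
    -- they are not flat when the four directions are in counterclockwise order
    (IsCounterclockwise M P u →
      IsProperParallelogram (-T 0) (T 1) (-T 2) (T 3) ∧
      IsProperParallelogram (T 0) (-T 1) (T 2) (-T 3)) ∧
    -- when the ratios of the triangle weights are defined, each class characterizes the
    -- weights that satisfy the plasticity equations
    (LinearIndependent ℝ ![u 0, u 1] → LinearIndependent ℝ ![u 1, u 2] →
      LinearIndependent ℝ ![u 0, u 2] →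
      ∀ (c : ℝ) (w' : Fin 4 → ℝ), (∀ i, 0 < w' i) → ∑ i, w' i = c →
      ∀ T' : Fin 4 → E3, T' = tangentPoint u w' →
        (PlasticityEquations u c w' ↔ IsParallelogram (-T' 0) (T' 1) (-T' 2) (T' 3)) ∧
        (PlasticityEquations u c w' ↔ IsParallelogram (T' 0) (-T' 1) (T' 2) (-T' 3))) := by
  have hbal : ∑ i, w i • u i = 0 := by
    simp only [hu]
    exact sum_smul_direction_eq_zero hM hQ hw hP hmin hγ
  have htan : ∀ (a : ℝ) i, IsTangent M P (a • u i) := fun a i => by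
    have := (hγ i).1.isTangent_smul_deriv 0 a
    rwa [(hγ i).2.1, ← hu] at this
  have hsum : ∑ i, T i = 0 := by
    rw [hT]
    exact hbal
  have hclassA := (isParallelogram_iff_sum_eq_zero T).2 hsum
  have hclassB := (isParallelogram_neg_iff_sum_eq_zero T).2 hsum
  refine ⟨fun i => ?_, hclassA, hclassB, ?_, ?_⟩
  · rw [hT]
    refine ⟨htan _ i, ?_, ?_⟩
    · rw [tangentPoint, norm_smul, hu, (hγ i).2.2.1, mul_one, Real.norm_of_nonneg (hw i).le]
    · have := (hγ i).1.isExp_smul (w i)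
      rwa [(hγ i).2.1, ← hu] at this
  · rintro ⟨ν, -, -, hccw⟩
    have hli := linearIndependent_add_add_of_counterclockwise hw hbal hccw
    refine ⟨⟨hclassA, ?_⟩, ⟨hclassB, ?_⟩⟩
    · simpa only [hT, tangentPoint, sub_neg_eq_add] using hli
    -- The Class B sides are the negatives of the Class A sides.
    · rw [LinearIndependent.pair_iff] at hli ⊢
      intro s t hst
      refine hli s t ?_
      rw [← neg_eq_zero, ← hst, hT]
      simp only [tangentPoint]
      module
  · intro h01 h12 h02 c w' hw' hc T' hT'
    obtain ⟨K₁, K₂, -, hcurv⟩ := hM.curvature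
    obtain ⟨κ, ⟨U, n, -, -, hU, hPU, hn, -⟩, -⟩ := hcurv P (hQ.subset hP.1)
    obtain ⟨hn1, hnt⟩ := hn.2 _ ⟨hQ.subset hP.1, hPU⟩
    have hnu : ∀ i, inner ℝ (n P) (u i) = 0 := fun i => hnt _ (by simpa using htan 1 i)
    have hn0 : n P ≠ 0 := norm_ne_zero_iff.1 (by rw [hn1]; exact one_ne_zero)
    have h := plasticityEquations_iff_sum_eq_zero hn0 hnu (hw' 0).ne' hc h01 h12 h02
    rw [← hT'] at h
    exact ⟨h.trans (isParallelogram_iff_sum_eq_zero T').symm,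
      h.trans (isParallelogram_neg_iff_sum_eq_zero T').symm⟩
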